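/- **Theorem (Upper bounds on the measure of Cartesian products of the Cantor set).** Let $\mathcal C\subset[0,1]$ be the ternary (middle-thirds) Cantor set and, for $d\ge 1$, let $\mathcal C^d\subset\mathbb R^d$ be its $d$-fold Cartesian product. Put $s_d:=d\log_3 2$, and let $$\mathcal H^{s}(F)=\lim_{\delta\to0}\inf\Bigl\{\sum_{i=1}^\infty|U_i|^{s}: F\subset\bigcup_{i=1}^\infty U_i,\ |U_i|\le\delta\text{ for all } i\Bigr\}$$ be the (unnormalised) $s$-dimensional Hausdorff measure on $\mathbb R^d$, where $|U|$ is the Euclidean diameter of $U$. Then $$\begin{aligned} \mathcal H^{s_2}(\mathcal C^2)&\le 1.500886049123709,\\ \mathcal H^{s_3}(\mathcal C^3)&\le 2.352741546983966,\\ \mathcal H^{s_4}(\mathcal C^4)&\le 4.089697707421688,\\ \mathcal H^{s_5}(\mathcal C^5)&\le 7.502183963990683,\\ \mathcal H^{s_6}(\mathcal C^6)&\le 14.810000552236708,\\ \mathcal H^{s_7}(\mathcal C^7)&\le 31.501011683100224,\\ \mathcal H^{s_8}(\mathcal C^8)&\le 67.52795132236503. \end{aligned}$$ -/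

import Mathlib

open MeasureTheory

/-- The `d`-fold Cartesian product of the ternary Cantor set, as a subset of Euclidean `d`-space.
Here `cantorSet` is Mathlib's `⋂ n, C n` with `C 0 = [0,1]` and
`C (n+1) = (C n) / 3 ∪ (2 + C n) / 3`. -/
def cantorPower (d : ℕ) : Set (EuclideanSpace ℝ (Fin d)) :=
  {x | ∀ i, x i ∈ cantorSet}

/-- The `d * log_3 2`-dimensional Hausdorff measure of the `d`-fold product of the Cantor set.
Diameters are Euclidean, and Mathlib's `μH[s]` carries no normalising constant: it is
`lim_{δ → 0} inf {∑ |U_i|^s : |U_i| ≤ δ, F ⊆ ⋃ U_i}`. -/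
noncomputable def cantorPowerMeasure (d : ℕ) : ENNReal :=
  μH[(d : ℝ) * Real.logb 3 2] (cantorPower d)

/-! The set `C^d` is the union of `2^(kd)` copies of itself of ratio `3^(-k)`, and each copy carries
the weight `3^(-ks) = 2^(-kd)`. If `U` contains a proportion `p` of the copies, cover these by `U`
and the others by shrunken covers of the whole set. The pre-measure `a` at a coarse scale then
satisfies `a ≤ |U|^s + (1 - p) a`, so `a ≤ |U|^s / p` since `a` is finite. Self-similarity carries
the bound to all finer scales, hence to the Hausdorff measure (`cantorPowerMeasure_mul_le`). For `U`
take balls about the centre of the unit cube that cut off its corners. The cubes inside are counted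
from below in integers, by a generating function for `d ≥ 3` and by subdivision for `d = 2`;
`cantorPowerMeasure_le` reduces the rest to an inequality of naturals. -/

open scoped ENNReal NNReal

/-! ### Stages of the Cantor set and of its powers -/

/-- The integers `a` such that `[a / 3 ^ k, (a + 1) / 3 ^ k]` is one of the `2 ^ k` intervals of the
`k`-th stage of the construction of the Cantor set. -/
def cantorNodes : ℕ → Finset ℕ
  | 0 => {0}
  | k + 1 => cantorNodes k ∪ (cantorNodes k).image (2 * 3 ^ k + ·)

lemma lt_of_mem_cantorNodes {k a : ℕ} (h : a ∈ cantorNodes k) : a < 3 ^ k := by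
  induction k generalizing a with
  | zero => simp_all [cantorNodes]
  | succ k ih =>
    simp only [cantorNodes, Finset.mem_union, Finset.mem_image] at h
    rw [pow_succ]
    obtain h | ⟨b, hb, rfl⟩ := h
    · have := ih h; omega
    · have := ih hb; omega

lemma sum_cantorNodes_succ {M : Type*} [AddCommMonoid M] (k : ℕ) (f : ℕ → M) :
    ∑ a ∈ cantorNodes (k + 1), f a =
      ∑ a ∈ cantorNodes k, f a + ∑ a ∈ cantorNodes k, f (2 * 3 ^ k + a) := by
  rw [cantorNodes, Finset.sum_union, Finset.sum_image (by intro a _ b _; simp)]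
  rw [Finset.disjoint_left]
  intro a ha h
  obtain ⟨b, -, rfl⟩ := Finset.mem_image.1 h
  have := lt_of_mem_cantorNodes ha
  omega

lemma card_cantorNodes (k : ℕ) : (cantorNodes k).card = 2 ^ k := by
  induction k with
  | zero => rfl
  | succ k ih =>
    rw [Finset.card_eq_sum_ones, sum_cantorNodes_succ, ← Finset.card_eq_sum_ones, ih]
    ring

/-- Each use of `C = C/3 ∪ (2 + C)/3` puts a new leading ternary digit, 0 or 2, before those of `a`;
this is the recursion of `cantorNodes`. -/
lemma exists_cantorNodes {x : ℝ} (hx : x ∈ cantorSet) (k : ℕ) :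
    ∃ a ∈ cantorNodes k, ∃ y ∈ cantorSet, x = ((3 : ℝ) ^ k)⁻¹ * (a + y) := by
  induction k generalizing x with
  | zero => exact ⟨0, by simp [cantorNodes], x, hx, by simp⟩
  | succ k ih =>
    rw [cantorSet_eq_union_halves] at hx
    obtain ⟨z, hz, rfl⟩ | ⟨z, hz, rfl⟩ := hx <;> obtain ⟨a, ha, y, hy, rfl⟩ := ih hz
    · refine ⟨a, by simp [cantorNodes, ha], y, hy, ?_⟩
      simp only [pow_succ]; field_simp
    · refine ⟨2 * 3 ^ k + a, by simp [cantorNodes, ha], y, hy, ?_⟩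
      push_cast
      simp only [pow_succ]; field_simp; ring

/-- The index set of the cubes of the `k`-th stage of the construction of `cantorPower d`. -/
def cantorCubes (d k : ℕ) : Finset (Fin d → ℕ) :=
  Fintype.piFinset fun _ ↦ cantorNodes k

lemma card_cantorCubes (d k : ℕ) : (cantorCubes d k).card = (2 ^ k) ^ d := by
  simp [cantorCubes, card_cantorNodes]

/-- The similarity of ratio `3 ^ (-k)` that maps the unit cube to the `k`-th stage cube of
index `c`. -/
noncomputable def cubeMap (d k : ℕ) (c : Fin d → ℕ) (x : EuclideanSpace ℝ (Fin d)) :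
    EuclideanSpace ℝ (Fin d) :=
  ((3 : ℝ) ^ k)⁻¹ • (WithLp.toLp 2 (fun i ↦ (c i : ℝ)) + x)

lemma lipschitzWith_cubeMap (d k : ℕ) (c : Fin d → ℕ) :
    LipschitzWith ((3 : ℝ≥0) ^ k)⁻¹ (cubeMap d k c) := by
  refine LipschitzWith.of_dist_le_mul fun x y ↦ ?_
  simp [cubeMap, dist_smul₀]

lemma cantorPower_subset_iUnion (d k : ℕ) :
    cantorPower d ⊆ ⋃ c ∈ cantorCubes d k, cubeMap d k c '' cantorPower d := by
  intro x hx
  choose a ha y hy h using fun i ↦ exists_cantorNodes (hx i) k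
  simp only [Set.mem_iUnion]
  refine ⟨a, by simpa [cantorCubes] using ha, WithLp.toLp 2 y, hy, ?_⟩
  ext i
  simp [cubeMap, h i, mul_add]

/-! ### Lipschitz images and pre-measures -/

section Scaling

variable {X : Type*} [EMetricSpace X]

/-- The outer measure obtained from the `s`-th powers of the diameters of sets of diameter at
most `r`. -/
noncomputable def hausdorffPre (s : ℝ) (r : ℝ≥0∞) : OuterMeasure X :=
  OuterMeasure.mkMetric'.pre (fun A ↦ Metric.ediam A ^ s) r

/-- The pre-measure is the largest outer measure dominated by `|B|^s` on sets of diameter at most `r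
/ K`. The pullback along `f`, divided by `K^s`, is another one so dominated. -/
lemma hausdorffPre_image_le {s : ℝ} (hs : 0 ≤ s) {K : ℝ≥0} (hK : K ≠ 0) {f : X → X}
    (hf : LipschitzWith K f) (r : ℝ≥0∞) (A : Set X) :
    hausdorffPre s r (f '' A) ≤ (K : ℝ≥0∞) ^ s * hausdorffPre s (r / K) A := by
  have hK' : (K : ℝ≥0∞) ≠ 0 := by simpa using hK
  have h0 : (K : ℝ≥0∞) ^ s ≠ 0 := by simp [ENNReal.rpow_eq_zero_iff, hK]
  have h1 : (K : ℝ≥0∞) ^ s ≠ ∞ := ENNReal.rpow_ne_top_of_nonneg hs ENNReal.coe_ne_top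
  have key : ((K : ℝ≥0∞) ^ s)⁻¹ • OuterMeasure.comap f (hausdorffPre s r) ≤
      hausdorffPre s (r / K) := by
    refine OuterMeasure.mkMetric'.le_pre.2 fun B hB ↦ ?_
    rw [smul_apply, OuterMeasure.comap_apply, smul_eq_mul,
      ENNReal.inv_mul_le_iff h0 h1, ← ENNReal.mul_rpow_of_nonneg _ _ hs]
    have hd := hf.ediam_image_le B
    refine (OuterMeasure.mkMetric'.pre_le (hd.trans ?_)).trans (ENNReal.rpow_le_rpow hd hs)
    rw [ENNReal.le_div_iff_mul_le (Or.inl hK') (Or.inl ENNReal.coe_ne_top)] at hB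
    rwa [mul_comm]
  have := key A
  rwa [smul_apply, OuterMeasure.comap_apply, smul_eq_mul,
    ENNReal.inv_mul_le_iff h0 h1] at this

end Scaling

/-! ### Self-similarity and the covering inequality -/

lemma inv_three_pow_rpow (d k : ℕ) :
    ((((3 : ℝ≥0) ^ k)⁻¹ : ℝ≥0) : ℝ≥0∞) ^ ((d : ℝ) * Real.logb 3 2) =
      (((2 ^ k) ^ d : ℕ) : ℝ≥0∞)⁻¹ := by
  have h : ((3 : ℝ≥0) ^ k) ^ ((d : ℝ) * Real.logb 3 2) = (((2 ^ k) ^ d : ℕ) : ℝ≥0) := by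
    apply NNReal.coe_injective
    push_cast
    rw [mul_comm (d : ℝ), Real.rpow_mul (by positivity), Real.rpow_natCast, ← Real.rpow_natCast 3 k,
      ← Real.rpow_mul (by norm_num), mul_comm (k : ℝ), Real.rpow_mul (by norm_num),
      Real.rpow_logb (by norm_num) (by norm_num) (by norm_num), Real.rpow_natCast]
  rw [ENNReal.coe_inv (by positivity), ENNReal.inv_rpow, ← ENNReal.coe_rpow_of_ne_zero
    (by positivity), h]
  simp

/-- The exponent is nonnegative. -/
lemma cantorPower_dim_nonneg (d : ℕ) : 0 ≤ (d : ℝ) * Real.logb 3 2 :=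
  mul_nonneg d.cast_nonneg (Real.logb_nonneg (by norm_num) (by norm_num))

lemma hausdorffPre_cubeMap_le (d k : ℕ) (c : Fin d → ℕ) (r : ℝ≥0∞) :
    hausdorffPre ((d : ℝ) * Real.logb 3 2) r (cubeMap d k c '' cantorPower d) ≤
      (((2 ^ k) ^ d : ℕ) : ℝ≥0∞)⁻¹ *
        hausdorffPre ((d : ℝ) * Real.logb 3 2) (3 ^ k * r) (cantorPower d) := by
  have := hausdorffPre_image_le (cantorPower_dim_nonneg d) (by positivity)
    (lipschitzWith_cubeMap d k c) r (cantorPower d)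
  rw [inv_three_pow_rpow] at this
  rw [ENNReal.coe_inv (by positivity), div_eq_mul_inv, inv_inv, mul_comm r] at this
  exact_mod_cast this

/-- Covering `cantorPower d` by `U`, which takes care of the cubes in `G`, and by covers of the
other cubes of the `k`-th stage. -/
lemma hausdorffPre_cantorPower_le (d k : ℕ) (U : Set (EuclideanSpace ℝ (Fin d)))
    (G : Finset (Fin d → ℕ))
    (hU : ∀ c ∈ G, cubeMap d k c '' cantorPower d ⊆ U) (r : ℝ≥0∞) (hr : Metric.ediam U ≤ r) :
    hausdorffPre ((d : ℝ) * Real.logb 3 2) r (cantorPower d) ≤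
      Metric.ediam U ^ ((d : ℝ) * Real.logb 3 2) +
        ((cantorCubes d k \ G).card : ℝ≥0∞) * ((((2 ^ k) ^ d : ℕ) : ℝ≥0∞)⁻¹ *
          hausdorffPre ((d : ℝ) * Real.logb 3 2) (3 ^ k * r) (cantorPower d)) := by
  set s := (d : ℝ) * Real.logb 3 2
  have hsub : cantorPower d ⊆
      U ∪ ⋃ c ∈ cantorCubes d k \ G, cubeMap d k c '' cantorPower d := by
    intro x hx
    have := cantorPower_subset_iUnion d k hx
    simp only [Set.mem_iUnion] at this
    obtain ⟨c, hc, hxc⟩ := this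
    by_cases h : c ∈ G
    · exact Or.inl (hU c h hxc)
    · refine Or.inr ?_
      simp only [Set.mem_iUnion]
      exact ⟨c, Finset.mem_sdiff.2 ⟨hc, h⟩, hxc⟩
  calc hausdorffPre s r (cantorPower d)
      ≤ hausdorffPre s r U +
        hausdorffPre s r (⋃ c ∈ cantorCubes d k \ G, cubeMap d k c '' cantorPower d) :=
        (measure_mono hsub).trans (measure_union_le _ _)
    _ ≤ _ := by
        gcongr
        · exact OuterMeasure.mkMetric'.pre_le hr
        · refine (measure_biUnion_finset_le _ _).trans ?_
          rw [← nsmul_eq_mul]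
          exact Finset.sum_le_card_nsmul _ _ _ fun c _ ↦ hausdorffPre_cubeMap_le d k c r

/-- The `2^(kd)` cubes have total weight 1, so refining the scale by `3^(-k)` costs nothing. -/
lemma hausdorffPre_cantorPower_le_scale (d k : ℕ) (r : ℝ≥0∞) :
    hausdorffPre ((d : ℝ) * Real.logb 3 2) r (cantorPower d) ≤
      hausdorffPre ((d : ℝ) * Real.logb 3 2) (3 ^ k * r) (cantorPower d) := by
  refine (measure_mono (cantorPower_subset_iUnion d k)).trans <|
    (measure_biUnion_finset_le _ _).trans <|
    (Finset.sum_le_card_nsmul _ _ _ fun c _ ↦ hausdorffPre_cubeMap_le d k c r).trans ?_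
  rw [nsmul_eq_mul, card_cantorCubes, ← mul_assoc, ENNReal.mul_inv_cancel, one_mul]
  · simp
  · exact ENNReal.natCast_ne_top _

lemma ediam_cantorPower_ne_top (d : ℕ) : Metric.ediam (cantorPower d) ≠ ∞ := by
  have h : Bornology.IsBounded (Set.univ.pi fun _ : Fin d ↦ cantorSet) :=
    (isCompact_univ_pi fun _ ↦ isCompact_cantorSet).isBounded
  have h2 := (PiLp.lipschitzWith_toLp 2 (fun _ : Fin d ↦ ℝ)).isBounded_image h
  refine Metric.isBounded_iff_ediam_ne_top.1 <| h2.subset fun x hx ↦ ⟨x.ofLp, fun i _ ↦ hx i, rfl⟩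

/-- The Hausdorff measure of `cantorPower d` is at most `|U| ^ s` divided by the proportion of
cubes of the `k`-th stage inside `U`. -/
theorem cantorPowerMeasure_mul_le (d k : ℕ) (U : Set (EuclideanSpace ℝ (Fin d)))
    (hUb : Metric.ediam U ≠ ∞) (G : Finset (Fin d → ℕ)) (hG : G ⊆ cantorCubes d k)
    (hU : ∀ c ∈ G, cubeMap d k c '' cantorPower d ⊆ U) :
    cantorPowerMeasure d * (G.card : ℝ≥0∞) ≤
      Metric.ediam U ^ ((d : ℝ) * Real.logb 3 2) * (((2 ^ k) ^ d : ℕ) : ℝ≥0∞) := by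
  set s := (d : ℝ) * Real.logb 3 2 with hs
  set T : ℝ≥0∞ := (((2 ^ k) ^ d : ℕ) : ℝ≥0∞) with hT
  have hT0 : T ≠ 0 := by simp [hT]
  have hTt : T ≠ ∞ := ENNReal.natCast_ne_top _
  obtain hG0 | hG0 := Nat.eq_zero_or_pos G.card
  · simp [hG0]
  have key : ∀ r > 0, hausdorffPre s r (cantorPower d) ≤
      Metric.ediam U ^ s * T / G.card := by
    intro r hr
    -- At scale `R` both `U` and `cantorPower d` itself are admissible covering sets; the latter
    -- makes `a` finite.
    set R : ℝ≥0∞ := max (Metric.ediam U) (Metric.ediam (cantorPower d)) with hR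
    have hRt : R < ∞ := max_lt hUb.lt_top (ediam_cantorPower_ne_top d).lt_top
    obtain ⟨n, hn⟩ : ∃ n : ℕ, R ≤ 3 ^ n * r := by
      obtain ⟨n, hn⟩ := ENNReal.exists_nat_mul_gt hr.ne' hRt.ne
      refine ⟨n, hn.le.trans ?_⟩
      gcongr
      exact_mod_cast (Nat.lt_pow_self (by norm_num : 1 < 3)).le
    have hle : hausdorffPre s r (cantorPower d) ≤ hausdorffPre s R (cantorPower d) :=
      (hausdorffPre_cantorPower_le_scale d n r).trans (OuterMeasure.mkMetric'.mono_pre _ hn _)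
    refine hle.trans ?_
    set a := hausdorffPre s R (cantorPower d) with ha
    have hat : a ≠ ∞ := by
      refine ne_top_of_le_ne_top ?_ (OuterMeasure.mkMetric'.pre_le (le_max_right _ _))
      exact ENNReal.rpow_ne_top_of_nonneg (cantorPower_dim_nonneg d)
        (ediam_cantorPower_ne_top d)
    have h1 : a ≤ Metric.ediam U ^ s + ((cantorCubes d k \ G).card : ℝ≥0∞) * (T⁻¹ * a) := by
      refine (hausdorffPre_cantorPower_le d k U G hU R (le_max_left _ _)).trans ?_
      gcongr
      refine OuterMeasure.mkMetric'.mono_pre _ ?_ _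
      exact le_mul_of_one_le_left' (one_le_pow₀ (by norm_num))
    have h2 : ((cantorCubes d k \ G).card : ℝ≥0∞) + G.card = T := by
      rw [hT, ← card_cantorCubes, ← Nat.cast_add, Finset.card_sdiff_add_card_eq_card hG]
    have h3 : a * T ≤ Metric.ediam U ^ s * T + ((cantorCubes d k \ G).card : ℝ≥0∞) * a := by
      calc a * T ≤ (Metric.ediam U ^ s + ((cantorCubes d k \ G).card : ℝ≥0∞) * (T⁻¹ * a)) * T := by
            gcongr
        _ = Metric.ediam U ^ s * T + ((cantorCubes d k \ G).card : ℝ≥0∞) * a * (T⁻¹ * T) := by ring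
        _ = _ := by rw [ENNReal.inv_mul_cancel hT0 hTt, mul_one]
    rw [ENNReal.le_div_iff_mul_le (Or.inl (by positivity)) (Or.inl (ENNReal.natCast_ne_top _))]
    rw [← h2, mul_add, add_comm, mul_comm _ a, h2] at h3
    -- Cancelling the contribution of the uncovered cubes needs `a ≠ ∞`.
    exact ENNReal.le_of_add_le_add_right
      (ENNReal.mul_ne_top hat (ENNReal.natCast_ne_top _)) h3
  have h4 : cantorPowerMeasure d ≤ Metric.ediam U ^ s * T / G.card := by
    rw [cantorPowerMeasure, Measure.hausdorffMeasure, ← Measure.coe_toOuterMeasure,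
      Measure.mkMetric_toOuterMeasure, OuterMeasure.mkMetric, OuterMeasure.mkMetric']
    simp only [OuterMeasure.iSup_apply]
    exact iSup₂_le key
  rwa [ENNReal.le_div_iff_mul_le (Or.inl (by positivity))
    (Or.inl (ENNReal.natCast_ne_top _))] at h4

/-! ### Cubes inside a centred ball -/

/-- The square of twice the distance from the point `3 ^ k / 2` to the farthest point of the
interval `[a, a + 3 ^ j]`. -/
def intervalFar (k j a : ℕ) : ℕ := max (3 ^ k - 2 * a) (2 * a + 2 * 3 ^ j - 3 ^ k) ^ 2

/-- A lower bound for the square of twice the distance from the point `3 ^ k / 2` to the interval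
`[a, a + 3 ^ j]`. -/
def intervalNear (k j a : ℕ) : ℕ := max (2 * a - 3 ^ k) (3 ^ k - (2 * a + 2 * 3 ^ j)) ^ 2

lemma intervalFar_mono {k i j a b : ℕ} (h : a ≤ b) (h' : b + 3 ^ i ≤ a + 3 ^ j) :
    intervalFar k i b ≤ intervalFar k j a := by
  unfold intervalFar
  gcongr ?_ ^ 2
  apply max_le_max <;> omega

/-- Truncated subtraction is harmless here: it only increases the two entries of the maximum. -/
lemma sq_le_intervalFar (k a : ℕ) {y : ℝ} (hy : y ∈ Set.Icc (0 : ℝ) 1) :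
    (2 * (a + y) - 3 ^ k) ^ 2 ≤ (intervalFar k 0 a : ℝ) := by
  obtain ⟨hy0, hy1⟩ := hy
  have h1 : ((3 : ℝ) ^ k - 2 * a) ≤ ((3 ^ k - 2 * a : ℕ) : ℝ) := by
    have h : 3 ^ k ≤ (3 ^ k - 2 * a) + 2 * a := by omega
    have : ((3 ^ k : ℕ) : ℝ) ≤ (((3 ^ k - 2 * a) + 2 * a : ℕ) : ℝ) := by exact_mod_cast h
    push_cast at this
    linarith
  have h2 : (2 * a + 2 - (3 : ℝ) ^ k) ≤ ((2 * a + 2 * 3 ^ 0 - 3 ^ k : ℕ) : ℝ) := by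
    have h : 2 * a + 2 ≤ (2 * a + 2 * 3 ^ 0 - 3 ^ k) + 3 ^ k := by omega
    have : ((2 * a + 2 : ℕ) : ℝ) ≤ (((2 * a + 2 * 3 ^ 0 - 3 ^ k) + 3 ^ k : ℕ) : ℝ) := by
      exact_mod_cast h
    push_cast at this ⊢
    linarith
  rw [intervalFar, Nat.cast_pow, Nat.cast_max]
  refine sq_le_sq' ?_ ?_
  · have := le_max_left ((3 ^ k - 2 * a : ℕ) : ℝ) ((2 * a + 2 * 3 ^ 0 - 3 ^ k : ℕ) : ℝ)
    linarith
  · have := le_max_right ((3 ^ k - 2 * a : ℕ) : ℝ) ((2 * a + 2 * 3 ^ 0 - 3 ^ k : ℕ) : ℝ)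
    linarith

/-- The indices of cubes of the `k`-th stage inside the ball about the centre of the unit cube
of diameter `√D / 3 ^ k`. -/
def cubesInBall (d k D : ℕ) : Finset (Fin d → ℕ) :=
  {c ∈ cantorCubes d k | ∑ i, intervalFar k 0 (c i) ≤ D}

lemma cubeMap_image_subset_closedBall {d k D : ℕ} {c : Fin d → ℕ}
    (hc : ∑ i, intervalFar k 0 (c i) ≤ D) :
    cubeMap d k c '' cantorPower d ⊆
      Metric.closedBall (WithLp.toLp 2 fun _ ↦ (1 / 2 : ℝ)) (√D / 3 ^ k / 2) := by
  rintro _ ⟨x, hx, rfl⟩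
  rw [Metric.mem_closedBall, EuclideanSpace.dist_eq]
  refine Real.sqrt_le_iff.2 ⟨by positivity, ?_⟩
  rw [div_pow, div_pow, Real.sq_sqrt (Nat.cast_nonneg D)]
  have h : ∀ i, dist ((cubeMap d k c x).ofLp i) (1 / 2) ^ 2 ≤
      (intervalFar k 0 (c i) : ℝ) / (3 ^ k) ^ 2 / 2 ^ 2 := by
    intro i
    have := sq_le_intervalFar k (c i) (cantorSet_subset_unitInterval (hx i))
    rw [Real.dist_eq, sq_abs, le_div_iff₀ (by positivity), le_div_iff₀ (by positivity)]
    refine le_trans (le_of_eq ?_) this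
    simp [cubeMap]
    field_simp
  refine (Finset.sum_le_sum fun i _ ↦ h i).trans ?_
  rw [← Finset.sum_div, ← Finset.sum_div]
  gcongr
  exact_mod_cast hc

/-- `665 / 1054` is a continued fraction convergent of `log_3 2`, from above. -/
lemma logb_three_two_le : Real.logb 3 2 ≤ 665 / 1054 := by
  rw [Real.logb_le_iff_le_rpow (by norm_num) (by norm_num),
    ← pow_le_pow_iff_left₀ (by norm_num) (by positivity) (show 1054 ≠ 0 by norm_num),
    ← Real.rpow_natCast (_ ^ _), ← Real.rpow_mul (by norm_num),
    show (665 / 1054 : ℝ) * (1054 : ℕ) = (665 : ℕ) by norm_num, Real.rpow_natCast]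
  exact_mod_cast (by decide +kernel : 2 ^ 1054 ≤ 3 ^ 665)

/-- A bound for the Hausdorff measure of `cantorPower d` in terms of the number of cubes in a
ball. -/
theorem cantorPowerMeasure_le {d k D N num den : ℕ} (hN0 : 0 < N) (hden : 0 < den)
    (hD : 9 ^ k ≤ D) (hN : N ≤ (cubesInBall d k D).card)
    (h : D ^ (665 * d) * (2 ^ (k * d) * den) ^ 2108 ≤ 9 ^ (k * (665 * d)) * (num * N) ^ 2108) :
    cantorPowerMeasure d ≤ ENNReal.ofReal (num / den) := by
  set s := (d : ℝ) * Real.logb 3 2 with hs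
  set t : ℝ := √D / 3 ^ k with ht
  have ht2 : t ^ 2 = D / 9 ^ k := by
    rw [ht, div_pow, Real.sq_sqrt (Nat.cast_nonneg D), ← pow_mul, mul_comm k, pow_mul]
    norm_num
  have ht0 : 0 ≤ t := by positivity
  have ht1 : 1 ≤ t := by
    rw [← one_le_sq_iff₀ ht0, ht2, one_le_div (by positivity)]
    exact_mod_cast hD
  have hts : t ^ s * 2 ^ (k * d) ≤ num / den * N := by
    -- Enlarging the exponent is allowed because `1 ≤ t`, which is what `hD` provides.
    have h1 : t ^ s ≤ t ^ ((d : ℝ) * (665 / 1054)) :=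
      Real.rpow_le_rpow_of_exponent_le ht1 (by rw [hs]; gcongr; exact logb_three_two_le)
    refine (mul_le_mul_of_nonneg_right h1 (by positivity)).trans ?_
    -- `2108 = 2 * 1054` clears both the denominator of the exponent and the square root in `t`.
    rw [← pow_le_pow_iff_left₀ (by positivity) (by positivity) (show 2108 ≠ 0 by norm_num),
      mul_pow, ← Real.rpow_natCast (t ^ _), ← Real.rpow_mul ht0]
    have h2 : t ^ ((d : ℝ) * (665 / 1054) * (2108 : ℕ)) =
        (D : ℝ) ^ (665 * d) / 9 ^ (k * (665 * d)) := by
      rw [show (d : ℝ) * (665 / 1054) * (2108 : ℕ) = ((2 * (665 * d) : ℕ) : ℝ) by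
        push_cast; ring, Real.rpow_natCast, pow_mul, ht2, div_pow, ← pow_mul]
    rw [h2, div_mul_eq_mul_div, div_le_iff₀ (by positivity), div_mul_eq_mul_div, div_pow,
      div_mul_eq_mul_div, le_div_iff₀ (by positivity), mul_assoc, ← mul_pow]
    have : ((D ^ (665 * d) * (2 ^ (k * d) * den) ^ 2108 : ℕ) : ℝ) ≤
      ((9 ^ (k * (665 * d)) * (num * N) ^ 2108 : ℕ) : ℝ) := Nat.cast_le.2 h
    push_cast at this
    rwa [mul_comm (_ ^ 2108)]
  set U := Metric.closedBall (WithLp.toLp 2 fun _ : Fin d ↦ (1 / 2 : ℝ)) (t / 2) with hU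
  have hd : Metric.ediam U ≤ ENNReal.ofReal t := by
    have : U = Metric.closedEBall (WithLp.toLp 2 fun _ : Fin d ↦ (1 / 2 : ℝ))
        (ENNReal.ofReal (t / 2)) := (Metric.closedEBall_ofReal (by positivity)).symm
    rw [this]
    refine Metric.ediam_closedEBall_le.trans (le_of_eq ?_)
    rw [← ENNReal.ofReal_ofNat, ← ENNReal.ofReal_mul (by norm_num)]
    congr 1; ring
  have hm := cantorPowerMeasure_mul_le d k U (ne_top_of_le_ne_top ENNReal.ofReal_ne_top hd)
    (cubesInBall d k D) (Finset.filter_subset _ _)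
    fun c hc ↦ cubeMap_image_subset_closedBall (Finset.mem_filter.1 hc).2
  have h0 : (N : ℝ≥0∞) ≠ 0 := by exact_mod_cast hN0.ne'
  rw [← ENNReal.mul_le_mul_iff_left h0 (ENNReal.natCast_ne_top N)]
  calc cantorPowerMeasure d * N ≤ cantorPowerMeasure d * (cubesInBall d k D).card := by gcongr
    _ ≤ Metric.ediam U ^ s * (((2 ^ k) ^ d : ℕ) : ℝ≥0∞) := hm
    _ ≤ ENNReal.ofReal t ^ s * (((2 ^ k) ^ d : ℕ) : ℝ≥0∞) := by
        gcongr
        exact cantorPower_dim_nonneg d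
    _ = ENNReal.ofReal (t ^ s * 2 ^ (k * d)) := by
        rw [ENNReal.ofReal_rpow_of_nonneg ht0 (cantorPower_dim_nonneg d),
          ENNReal.ofReal_mul (by positivity), ← ENNReal.ofReal_natCast]
        push_cast
        rw [pow_mul]
    _ ≤ ENNReal.ofReal (num / den * N) := ENNReal.ofReal_le_ofReal hts
    _ = ENNReal.ofReal (num / den) * N := by
        rw [ENNReal.ofReal_mul (by positivity), ENNReal.ofReal_natCast]

/-! ### Counting by a generating function -/

/-- The number of tuples in `S ^ d` with `∑ g ≤ T`, read off from the generating function of `g`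
evaluated at `2 ^ W`. -/
lemma card_filter_sum_le_eq_mod (S : Finset ℕ) (g : ℕ → ℕ) (d W T : ℕ)
    (hW : S.card ^ d + 1 < 2 ^ W) :
    ((Fintype.piFinset fun _ : Fin d ↦ S).filter fun c ↦ ∑ i, g (c i) ≤ T).card =
      (∑ a ∈ S, 2 ^ (W * g a)) ^ d % 2 ^ (W * (T + 1)) % (2 ^ W - 1) := by
  set P := Fintype.piFinset fun _ : Fin d ↦ S
  set A := P.filter fun c ↦ ∑ i, g (c i) ≤ T with hA
  have hcard : A.card ≤ S.card ^ d := (Finset.card_filter_le _ _).trans (by simp [P])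
  have hpow : (∑ a ∈ S, 2 ^ (W * g a)) ^ d = ∑ c ∈ P, 2 ^ (W * ∑ i, g (c i)) := by
    have h := Finset.prod_univ_sum (fun _ : Fin d ↦ S) fun _ a ↦ 2 ^ (W * g a)
    rw [Finset.prod_const, Finset.card_univ, Fintype.card_fin] at h
    rw [h]
    refine Finset.sum_congr rfl fun c _ ↦ ?_
    rw [Finset.prod_pow_eq_pow_sum, Finset.mul_sum]
  have hsplit := Finset.sum_filter_add_sum_filter_not P (fun c ↦ ∑ i, g (c i) ≤ T)
    fun c ↦ 2 ^ (W * ∑ i, g (c i))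
  have hhigh : 2 ^ (W * (T + 1)) ∣
      ∑ c ∈ P with ¬ ∑ i, g (c i) ≤ T, 2 ^ (W * ∑ i, g (c i)) := by
    refine Finset.dvd_sum fun c hc ↦ pow_dvd_pow _ ?_
    have := (Finset.mem_filter.1 hc).2
    gcongr
    omega
  have hlow : ∑ c ∈ A, 2 ^ (W * ∑ i, g (c i)) < 2 ^ (W * (T + 1)) := by
    calc ∑ c ∈ A, 2 ^ (W * ∑ i, g (c i)) ≤ ∑ _c ∈ A, 2 ^ (W * T) := by
          refine Finset.sum_le_sum fun c hc ↦ ?_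
          have := (Finset.mem_filter.1 hc).2
          gcongr
          norm_num
      _ = A.card * 2 ^ (W * T) := by simp
      _ < 2 ^ W * 2 ^ (W * T) := by gcongr; omega
      _ = 2 ^ (W * (T + 1)) := by rw [← pow_add]; congr 1; ring
  obtain ⟨m, hm⟩ := hhigh
  -- The first remainder truncates the polynomial in `x = 2^W` to degree at most `T`.
  rw [hpow, ← hsplit, ← hA, hm, Nat.add_mul_mod_self_left, Nat.mod_eq_of_lt hlow]
  -- Modulo `2^W - 1` the variable `x` becomes 1, so the coefficients are added up; `hW` makes the
  -- sum smaller than the modulus.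
  have h1 : 2 ^ W ≡ 1 [MOD 2 ^ W - 1] :=
    ((Nat.modEq_iff_dvd' Nat.one_le_two_pow).2 dvd_rfl).symm
  have h2 : ∑ c ∈ A, 2 ^ (W * ∑ i, g (c i)) ≡ ∑ _c ∈ A, 1 [MOD 2 ^ W - 1] := by
    refine Nat.ModEq.sum fun c _ ↦ ?_
    rw [pow_mul]
    simpa using h1.pow (∑ i, g (c i))
  rw [h2, Finset.sum_const, smul_eq_mul, mul_one, Nat.mod_eq_of_lt (by omega)]

/-- A tree-recursive form of a sum over `cantorNodes k`, translated by `a`. -/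
def nodeSum (f : ℕ → ℕ) : ℕ → ℕ → ℕ
  | 0, a => f a
  | k + 1, a => nodeSum f k a + nodeSum f k (a + 2 * 3 ^ k)

lemma nodeSum_eq (f : ℕ → ℕ) (k a : ℕ) : nodeSum f k a = ∑ b ∈ cantorNodes k, f (a + b) := by
  induction k generalizing a with
  | zero => simp [nodeSum, cantorNodes]
  | succ k ih => simp [nodeSum, sum_cantorNodes_succ, ih, add_assoc]

/-- A computable lower bound for the number of cubes of the `k`-th stage in a ball. -/
def ballCount (d k q T : ℕ) : ℕ :=
  nodeSum (fun a ↦ 2 ^ ((d * k + 1) * ((intervalFar k 0 a + (q - 1)) / q))) k 0 ^ d %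
    2 ^ ((d * k + 1) * (T + 1)) % (2 ^ (d * k + 1) - 1)

/-- Dividing by `q` keeps the degrees small. Since the quotients are rounded up, cubes can only be
lost. -/
lemma ballCount_le {d k q : ℕ} (T : ℕ) (hq : 0 < q) (hdk : 1 < d * k) :
    ballCount d k q T ≤ (cubesInBall d k (q * T)).card := by
  have hW : (cantorNodes k).card ^ d + 1 < 2 ^ (d * k + 1) := by
    rw [card_cantorNodes, ← pow_mul, mul_comm k, pow_succ]
    have := Nat.pow_lt_pow_right (a := 2) (by norm_num) hdk
    omega
  have h := card_filter_sum_le_eq_mod (cantorNodes k)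
    (fun a ↦ (intervalFar k 0 a + (q - 1)) / q) d _ T hW
  rw [ballCount, nodeSum_eq]
  simp only [zero_add]
  rw [← h]
  refine Finset.card_le_card fun c hc ↦ ?_
  obtain ⟨hc1, hc2⟩ := Finset.mem_filter.1 hc
  refine Finset.mem_filter.2 ⟨hc1, (Finset.sum_le_sum fun i _ ↦ ?_).trans
    ((Finset.mul_sum Finset.univ _ q).symm.le.trans (Nat.mul_le_mul_left q hc2))⟩
  have h1 := Nat.div_add_mod (intervalFar k 0 (c i) + (q - 1)) q
  have h2 := Nat.mod_lt (intervalFar k 0 (c i) + (q - 1)) hq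
  omega

/-! ### Counting squares in a disc by subdivision -/

/-- A lower bound for the number of stage `k` squares in a disc that lie in the square
`[a, a + 3 ^ j] × [b, b + 3 ^ j]`, computed by subdivision. -/
def discCount (k D : ℕ) : ℕ → ℕ → ℕ → ℕ
  | 0, a, b => bif Nat.ble (intervalFar k 0 a + intervalFar k 0 b) D then 1 else 0
  | j + 1, a, b =>
    bif Nat.ble (intervalFar k (j + 1) a + intervalFar k (j + 1) b) D then 4 ^ (j + 1)
    else bif Nat.ble (intervalNear k (j + 1) a + intervalNear k (j + 1) b) D then
      discCount k D j a b + discCount k D j a (b + 2 * 3 ^ j) +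
        (discCount k D j (a + 2 * 3 ^ j) b + discCount k D j (a + 2 * 3 ^ j) (b + 2 * 3 ^ j))
    else 0

/-- A square inside the disc at its farthest point contributes all its `4^j` descendants. Discarding
a square by `intervalNear` needs no justification, since 0 only lowers the count. -/
lemma discCount_le (k D j a b : ℕ) :
    discCount k D j a b ≤ ∑ u ∈ cantorNodes j, ∑ v ∈ cantorNodes j,
      if intervalFar k 0 (a + u) + intervalFar k 0 (b + v) ≤ D then 1 else 0 := by
  induction j generalizing a b with
  | zero => simp [discCount, cantorNodes, Bool.cond_eq_ite, -Finset.sum_boole]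
  | succ j ih =>
    rw [discCount, Bool.cond_eq_ite]
    split_ifs with h
    · rw [Nat.ble_eq] at h
      rw [Finset.sum_congr rfl fun u hu ↦ Finset.sum_congr rfl fun v hv ↦ if_pos ?_]
      · simp only [Finset.sum_const, card_cantorNodes, smul_eq_mul, mul_one, ← mul_pow]
        norm_num
      · have hu' := lt_of_mem_cantorNodes hu
        have hv' := lt_of_mem_cantorNodes hv
        refine le_trans (add_le_add (intervalFar_mono ?_ ?_) (intervalFar_mono ?_ ?_)) h <;>
        omega
    · rw [Bool.cond_eq_ite]
      split_ifs
      · simp only [sum_cantorNodes_succ, Finset.sum_add_distrib, ← add_assoc]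
        have h1 := ih a b
        have h2 := ih a (b + 2 * 3 ^ j)
        have h3 := ih (a + 2 * 3 ^ j) b
        have h4 := ih (a + 2 * 3 ^ j) (b + 2 * 3 ^ j)
        omega
      · exact Nat.zero_le _

lemma discCount_le_card (k D : ℕ) : discCount k D k 0 0 ≤ (cubesInBall 2 k D).card := by
  refine (discCount_le k D k 0 0).trans ?_
  simp only [zero_add]
  rw [← Finset.sum_product', ← Finset.card_filter]
  refine Finset.card_le_card_of_injOn (fun p ↦ ![p.1, p.2]) ?_ ?_
  · rintro ⟨u, v⟩ h
    simpa [cubesInBall, cantorCubes, Fin.forall_fin_two] using h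
  · rintro ⟨u, v⟩ _ ⟨u', v'⟩ _ h
    simpa using h

/-! ### Numerical counts; the factor `2 ^ d` reflects the symmetries `x_i ↦ 1 - x_i` -/

lemma le_ballCount_three : 8 * 117602906 ≤ ballCount 3 10 249886 29967 := by decide +kernel

lemma le_ballCount_four : 16 * 212345662 ≤ ballCount 4 8 35872 3042 := by decide +kernel

lemma le_ballCount_five : 32 * 851573186 ≤ ballCount 5 7 14348 1032 := by decide +kernel

lemma le_ballCount_six : 64 * 789628624 ≤ ballCount 6 6 1860 1005 := by decide +kernel

lemma le_ballCount_seven : 128 * 193464237 ≤ ballCount 7 5 787 306 := by decide +kernel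

lemma le_ballCount_eight : 256 * 2968936884 ≤ ballCount 8 5 885 304 := by decide +kernel

lemma le_discCount : 4 * 62337552 ≤ discCount 14 38737618576730 14 0 0 := by decide +kernel

theorem mainTheorem2 :
    cantorPowerMeasure 2 ≤ ENNReal.ofReal 1.500886049123709 ∧
    cantorPowerMeasure 3 ≤ ENNReal.ofReal 2.352741546983966 ∧
    cantorPowerMeasure 4 ≤ ENNReal.ofReal 4.089697707421688 ∧
    cantorPowerMeasure 5 ≤ ENNReal.ofReal 7.502183963990683 ∧
    cantorPowerMeasure 6 ≤ ENNReal.ofReal 14.810000552236708 ∧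
    cantorPowerMeasure 7 ≤ ENNReal.ofReal 31.501011683100224 ∧
    cantorPowerMeasure 8 ≤ ENNReal.ofReal 67.52795132236503 := by
  refine ⟨?_, ?_, ?_, ?_, ?_, ?_, ?_⟩
  · refine (cantorPowerMeasure_le (num := 1500886049123709) (den := 10 ^ 15) (by norm_num)
      (by norm_num) (by norm_num) (le_discCount.trans (discCount_le_card _ _))
      (by decide +kernel)).trans_eq ?_
    norm_num
  · refine (cantorPowerMeasure_le (num := 2352741546983966) (den := 10 ^ 15) (by norm_num)
      (by norm_num) (by norm_num) (le_ballCount_three.trans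
      (ballCount_le _ (by norm_num) (by norm_num))) (by decide +kernel)).trans_eq ?_
    norm_num
  · refine (cantorPowerMeasure_le (num := 4089697707421688) (den := 10 ^ 15) (by norm_num)
      (by norm_num) (by norm_num) (le_ballCount_four.trans
      (ballCount_le _ (by norm_num) (by norm_num))) (by decide +kernel)).trans_eq ?_
    norm_num
  · refine (cantorPowerMeasure_le (num := 7502183963990683) (den := 10 ^ 15) (by norm_num)
      (by norm_num) (by norm_num) (le_ballCount_five.trans
      (ballCount_le _ (by norm_num) (by norm_num))) (by decide +kernel)).trans_eq ?_
    norm_num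
  · refine (cantorPowerMeasure_le (num := 14810000552236708) (den := 10 ^ 15) (by norm_num)
      (by norm_num) (by norm_num) (le_ballCount_six.trans
      (ballCount_le _ (by norm_num) (by norm_num))) (by decide +kernel)).trans_eq ?_
    norm_num
  · refine (cantorPowerMeasure_le (num := 31501011683100224) (den := 10 ^ 15) (by norm_num)
      (by norm_num) (by norm_num) (le_ballCount_seven.trans
      (ballCount_le _ (by norm_num) (by norm_num))) (by decide +kernel)).trans_eq ?_
    norm_num
  · refine (cantorPowerMeasure_le (num := 6752795132236503) (den := 10 ^ 14) (by norm_num)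
      (by norm_num) (by norm_num) (le_ballCount_eight.trans
      (ballCount_le _ (by norm_num) (by norm_num))) (by decide +kernel)).trans_eq ?_
    norm_num
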